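/- A hypergraph $\mathcal H=(V,E)$ consists of a finite set $V$ and a finite multiset $E$ of non-empty subsets of $V$ (hyperedges). Its associated bipartite graph $\mathrm{Bip}\,\mathcal H$ has colour classes $V$ and $E$ (repeated hyperedges being distinct elements of $E$), with $v\in V$ adjacent to $e\in E$ if and only if $v\in e$. For $\emptyset\ne S\subseteq E$ let $\mu(S)=\left|\bigcup S\right|-c(S)$, where $c(S)$ is the number of connected components of the subgraph of $\mathrm{Bip}\,\mathcal H$ formed by $S$, all edges incident with elements of $S$, and their endpoints in $V$; let $\mu(\emptyset)=0$. Enumerate $E$ as $\{e_1,\dots,e_n\}$, $n=|E|$, in an arbitrary order, and let $$P_{\mathcal H}=\Big\{a\in\mathbb Z^n:\ \sum_{i\in I}a_i\le\mu(\{e_i:i\in I\})\text{ for all }I\subseteq\{1,\dots,n\},\ \text{and}\ \sum_{i=1}^n a_i=\mu(E)\Big\},$$ which is a finite set. Let $\mathbf e_1,\dots,\mathbf e_n$ be the standard basis of $\mathbb Z^n$. For $a\in P_{\mathcal H}$ let $\mathrm{Int}(a)$ be the set of the indices $i$ such that $a-\mathbf e_i+\mathbf e_j\notin P_{\mathcal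 H}$ for all $j<i$, and $\mathrm{Ext}(a)$ the set of the indices $i$ such that $a+\mathbf e_i-\mathbf e_j\notin P_{\mathcal H}$ for all $j<i$. The interior and the exterior polynomial of $\mathcal H$ are $$I_{\mathcal H}(x)=\sum_{a\in P_{\mathcal H}}x^{\,n-|\mathrm{Int}(a)|},\qquad X_{\mathcal H}(y)=\sum_{a\in P_{\mathcal H}}y^{\,n-|\mathrm{Ext}(a)|}.$$ **Corollary 4.8.** Let $\mathcal H=(V,E)$ and $\mathcal H'=(V',E')$ be two hypergraphs, with $\mathrm{Bip}\,\mathcal H$ and $\mathrm{Bip}\,\mathcal H'$ not necessarily connected. Suppose that $\mathrm{Bip}\,\mathcal H'$ is a subgraph of $\mathrm{Bip}\,\mathcal H$, with $V'\subseteq V$ and $E'\subseteq E$ for the colour classes. Then, for any orderings of $E$ and of $E'$ (chosen independently), each coefficient of $I_{\mathcal H'}$ is less than or equal to the corresponding coefficient of $I_{\mathcal H}$, and each coefficient of $X_{\mathcal H'}$ is less than or equal to the corresponding coefficient of $X_{\mathcal H}$. -/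

import Mathlib

noncomputable section

open Finset Polynomial

/-! ### Polymatroids over `Fin n`, activities, interior and exterior polynomials -/

/-- The polymatroid (set of integer bases) given by `f : 2^[n] → ℤ`: all integer vectors `a` with
`∑_{i ∈ I} a_i ≤ f I` for every `I` and `∑_i a_i = f [n]`. -/
def polymatroid {n : ℕ} (f : Finset (Fin n) → ℤ) : Set (Fin n → ℤ) :=
  {a | (∀ I : Finset (Fin n), ∑ i ∈ I, a i ≤ f I) ∧ ∑ i, a i = f univ}

theorem polymatroid_finite {n : ℕ} (f : Finset (Fin n) → ℤ) : (polymatroid f).Finite := by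
  refine (Set.finite_Icc (fun i => f univ - f (univ.erase i)) (fun i => f {i})).subset ?_
  rintro a ⟨h, hs⟩
  refine ⟨fun i => ?_, fun i => ?_⟩
  · have h1 := h (univ.erase i)
    have h2 := Finset.add_sum_erase univ a (mem_univ i)
    simp only
    linarith
  · simpa using h {i}

open Classical in
/-- The internally active indices of `a` with respect to `P`: those `i` such that
`a - e_i + e_j ∉ P` for every `j < i`. -/
def internallyActive {n : ℕ} (P : Set (Fin n → ℤ)) (a : Fin n → ℤ) : Finset (Fin n) :=
  {i | ∀ j < i, a - Pi.single i 1 + Pi.single j 1 ∉ P}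

open Classical in
/-- The externally active indices of `a` with respect to `P`: those `i` such that
`a + e_i - e_j ∉ P` for every `j < i`. -/
def externallyActive {n : ℕ} (P : Set (Fin n → ℤ)) (a : Fin n → ℤ) : Finset (Fin n) :=
  {i | ∀ j < i, a + Pi.single i 1 - Pi.single j 1 ∉ P}

/-- `I_P(x) = ∑_{a ∈ P} x^(n - |Int_P(a)|)`. -/
def interiorPolynomial {n : ℕ} (P : Set (Fin n → ℤ)) (hP : P.Finite) : ℤ[X] :=
  ∑ a ∈ hP.toFinset, X ^ (n - #(internallyActive P a))

/-- `X_P(y) = ∑_{a ∈ P} y^(n - |Ext_P(a)|)`. -/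
def exteriorPolynomial {n : ℕ} (P : Set (Fin n → ℤ)) (hP : P.Finite) : ℤ[X] :=
  ∑ a ∈ hP.toFinset, X ^ (n - #(externallyActive P a))

/-! ### Hypergraphs -/

/-- A hypergraph `(V, E)`: `V` is a finite set of vertices (taken from `α`), and the finite multiset
`E` of non-empty subsets of `V` is given as a finite family `e ↦ carrier e`, whose labels `e` are
taken from `β`; so the same subset may occur several times. -/
structure LabelledHypergraph (α β : Type*) where
  /-- the vertex set `V` -/
  verts : Finset α
  /-- the (labels of the) hyperedges `E` -/
  edges : Finset β
  /-- the set of vertices of a hyperedge (irrelevant for labels outside `edges`) -/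
  carrier : β → Finset α
  carrier_subset : ∀ e ∈ edges, carrier e ⊆ verts
  carrier_nonempty : ∀ e ∈ edges, (carrier e).Nonempty

namespace LabelledHypergraph

variable {α β : Type*}

/-- The associated bipartite graph `Bip H`, with colour classes `V` and `E`, in which `v ∈ V` is
adjacent to `e ∈ E` if and only if `v` belongs to `e`. -/
def bip (H : LabelledHypergraph α β) : (completeBipartiteGraph α β).Subgraph where
  verts := {x | (∃ v ∈ H.verts, x = Sum.inl v) ∨ ∃ e ∈ H.edges, x = Sum.inr e}
  Adj x y := ∃ e ∈ H.edges, ∃ v ∈ H.carrier e,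
    (x = Sum.inl v ∧ y = Sum.inr e) ∨ (x = Sum.inr e ∧ y = Sum.inl v)
  adj_sub := by
    rintro x y ⟨e, _, v, _, ⟨rfl, rfl⟩ | ⟨rfl, rfl⟩⟩ <;> simp
  edge_vert := by
    rintro x y ⟨e, he, v, hv, ⟨rfl, rfl⟩ | ⟨rfl, rfl⟩⟩
    · exact Or.inl ⟨v, H.carrier_subset e he hv, rfl⟩
    · exact Or.inr ⟨e, he, rfl⟩
  symm := ⟨by
    rintro x y ⟨e, he, v, hv, h⟩
    exact ⟨e, he, v, hv, by tauto⟩⟩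

/-- The bipartite graph `Bip H|_{S}` for a set `S` of hyperedges: it consists of `S`, all edges of
`Bip H` incident with elements of `S`, and their endpoints among the vertices of `H`. -/
def bipRestrict (H : LabelledHypergraph α β) (S : Finset β) :
    (completeBipartiteGraph α β).Subgraph where
  verts := {x | (∃ e ∈ S, e ∈ H.edges ∧ x = Sum.inr e) ∨
    ∃ e ∈ S, e ∈ H.edges ∧ ∃ v ∈ H.carrier e, x = Sum.inl v}
  Adj x y := ∃ e ∈ S, e ∈ H.edges ∧ ∃ v ∈ H.carrier e,
    (x = Sum.inl v ∧ y = Sum.inr e) ∨ (x = Sum.inr e ∧ y = Sum.inl v)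
  adj_sub := by
    rintro x y ⟨e, _, _, v, _, ⟨rfl, rfl⟩ | ⟨rfl, rfl⟩⟩ <;> simp
  edge_vert := by
    rintro x y ⟨e, he, he', v, hv, ⟨rfl, rfl⟩ | ⟨rfl, rfl⟩⟩
    · exact Or.inr ⟨e, he, he', v, hv, rfl⟩
    · exact Or.inl ⟨e, he, he', rfl⟩
  symm := ⟨by
    rintro x y ⟨e, he, he', v, hv, h⟩
    exact ⟨e, he, he', v, hv, by tauto⟩⟩

open Classical in
/-- `μ(∅) = 0`, and `μ(S) = |⋃ S| - c(S)` for `S ≠ ∅`, where `c(S)` is the number of connected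
components of `Bip H|_S`. -/
def mu (H : LabelledHypergraph α β) (S : Finset β) : ℤ :=
  if S = ∅ then 0
  else (#(S.biUnion H.carrier) : ℤ) - (Nat.card (H.bipRestrict S).coe.ConnectedComponent : ℤ)

/-- The function `μ`, transported to subsets of `[n]` by an enumeration `σ` of the hyperedges. -/
def rank (H : LabelledHypergraph α β) {n : ℕ} (σ : Fin n ≃ H.edges) (I : Finset (Fin n)) : ℤ :=
  H.mu (I.map (σ.toEmbedding.trans (Function.Embedding.subtype _)))

/-- The hypergraphical polymatroid `P_H` (the set of all hypertrees of `H`), as a polymatroid over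
`[n]` by means of the enumeration `σ` of the hyperedges. -/
def hypertrees (H : LabelledHypergraph α β) {n : ℕ} (σ : Fin n ≃ H.edges) : Set (Fin n → ℤ) :=
  polymatroid (H.rank σ)

/-- The interior polynomial `I_H`, computed with the hyperedges ordered by `σ`. -/
def interior (H : LabelledHypergraph α β) {n : ℕ} (σ : Fin n ≃ H.edges) : ℤ[X] :=
  interiorPolynomial (H.hypertrees σ) (polymatroid_finite _)

/-- The exterior polynomial `X_H`, computed with the hyperedges ordered by `σ`. -/
def exterior (H : LabelledHypergraph α β) {n : ℕ} (σ : Fin n ≃ H.edges) : ℤ[X] :=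
  exteriorPolynomial (H.hypertrees σ) (polymatroid_finite _)

end LabelledHypergraph

end

section

open Finset Polynomial

/-! ### Integer vectors closed under exchange -/

/-! The only properties of `P_H` that matter are its basis exchange axioms, and the result reduces
to monotonicity under inclusion: if Q ⊆ P are both exchange closed, the coefficients of the interior
polynomial of Q are at most those of P. Negation turns exterior polynomials into interior ones.

Independence of the order comes from counting. Each integer vector c below P is uniquely a - d with
a ∈ P and d ≥ 0 supported on the active indices of a. So ∑ (1/(1-x))^|Int(a)| counts such c by
coordinate sum, with no reference to the order; multiplied by (1-x)^n it becomes I(1-x).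

Monotonicity is by induction on the coordinates that may vary. For one of them, t, let c be the
minimum of a_t on Q. With t last in the order, both polynomials split into the part a_t ≤ c plus x
times each slice a_t = k, k > c. The slices compare by induction. The part of Q is its slice a_t =
c, dominated inductively by the slice of P, which is the top slice of the part a_t ≤ c of P.
Reordering so that t comes first, a top slice is dominated by the whole.

For hypergraphs, μ(S) is the dimension of a sum of "star" subspaces minus |S|, since the edge
vectors of a graph span dimension (vertices - components). Passing to a subgraph shrinks or drops
stars. A base v' of the rank function relative to the span T of all the small stars, lowered by 1 at
each dropped hyperedge, translates `P_{H'}`, extended by zeros, into `P_H`. -/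

theorem exchange_apply {ι : Type*} [DecidableEq ι] (a : ι → ℤ) (i j k : ι) :
    (a - Pi.single i 1 + Pi.single j 1 : ι → ℤ) k
      = a k - (if k = i then 1 else 0) + (if k = j then 1 else 0) := by
  simp [Pi.single_apply]

theorem exchange_apply' {ι : Type*} [DecidableEq ι] (a : ι → ℤ) (i j k : ι) :
    (a + Pi.single i 1 - Pi.single j 1 : ι → ℤ) k
      = a k + (if k = i then 1 else 0) - (if k = j then 1 else 0) := by
  simp [Pi.single_apply]

section Exchange

variable {ι : Type*} [Fintype ι] [DecidableEq ι]

/-- A finite set of integer vectors of constant coordinate sum with the exchange properties of the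
integer points of a base polyhedron. -/
structure ExchangeClosed (P : Finset (ι → ℤ)) : Prop where
  sum_eq : ∀ a ∈ P, ∀ b ∈ P, ∑ i, a i = ∑ i, b i
  lower : ∀ a ∈ P, ∀ b ∈ P, ∀ i, b i < a i →
    ∃ j, a j < b j ∧ a - Pi.single i 1 + Pi.single j 1 ∈ P
  raise : ∀ a ∈ P, ∀ b ∈ P, ∀ i, a i < b i →
    ∃ j, b j < a j ∧ a + Pi.single i 1 - Pi.single j 1 ∈ P

/-- The internally inactive indices of `a`, for the order on the indices given by `r`. -/
def inactive (r : ι → ℕ) (P : Finset (ι → ℤ)) (a : ι → ℤ) : Finset ι :=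
  {i | ∃ j, r j < r i ∧ a - Pi.single i 1 + Pi.single j 1 ∈ P}

/-- The interior polynomial for the order on the indices given by `r`. -/
noncomputable def interiorPoly (r : ι → ℕ) (P : Finset (ι → ℤ)) : ℤ[X] :=
  ∑ a ∈ P, X ^ #(inactive r P a)

theorem mem_inactive {r : ι → ℕ} {P : Finset (ι → ℤ)} {a : ι → ℤ} {i : ι} :
    i ∈ inactive r P a ↔ ∃ j, r j < r i ∧ a - Pi.single i 1 + Pi.single j 1 ∈ P := by
  simp [inactive]

namespace ExchangeClosed

/-- Swaps lowering and raising; this is what carries results about interior polynomials over to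
exterior ones. -/
theorem neg {P : Finset (ι → ℤ)} (h : ExchangeClosed P) :
    ExchangeClosed (P.image fun a => -a) := by
  refine ⟨?_, ?_, ?_⟩
  · simp only [mem_image]
    rintro _ ⟨a, ha, rfl⟩ _ ⟨b, hb, rfl⟩
    simp [h.sum_eq a ha b hb]
  · simp only [mem_image]
    rintro _ ⟨a, ha, rfl⟩ _ ⟨b, hb, rfl⟩ i hi
    obtain ⟨j, hj, hj'⟩ := h.raise a ha b hb i (by simpa using hi)
    exact ⟨j, by simpa using hj, _, hj', by abel⟩
  · simp only [mem_image]
    rintro _ ⟨a, ha, rfl⟩ _ ⟨b, hb, rfl⟩ i hi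
    obtain ⟨j, hj, hj'⟩ := h.lower a ha b hb i (by simpa using hi)
    exact ⟨j, by simpa using hj, _, hj', by abel⟩

/-- Restricting one coordinate to an interval preserves the exchange properties. -/
theorem filter_ordConnected {P : Finset (ι → ℤ)} (h : ExchangeClosed P) (t : ι) (p : ℤ → Prop)
    [DecidablePred p] (hp : ∀ x y z, p x → p z → x ≤ y → y ≤ z → p y) :
    ExchangeClosed (P.filter fun a => p (a t)) := by
  refine ⟨fun a ha b hb => h.sum_eq a (mem_filter.1 ha).1 b (mem_filter.1 hb).1, ?_, ?_⟩
  · intro a ha b hb i hi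
    rw [mem_filter] at ha hb
    obtain ⟨j, hj, hj'⟩ := h.lower a ha.1 b hb.1 i hi
    refine ⟨j, hj, mem_filter.2 ⟨hj', ?_⟩⟩
    rw [exchange_apply]
    -- The exchange moves coordinates of a only one step towards those of b, so the new value at t
    -- lies between b t and a t.
    by_cases h1 : t = i
    · have h2 : t ≠ j := by rintro rfl; subst h1; omega
      subst h1
      exact hp (b t) _ (a t) hb.2 ha.2 (by simp [h2]; omega) (by simp [h2])
    · by_cases h2 : t = j
      · subst h2
        exact hp (a t) _ (b t) ha.2 hb.2 (by simp [h1]) (by simp [h1]; omega)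
      · simpa [h1, h2] using ha.2
  · intro a ha b hb i hi
    rw [mem_filter] at ha hb
    obtain ⟨j, hj, hj'⟩ := h.raise a ha.1 b hb.1 i hi
    refine ⟨j, hj, mem_filter.2 ⟨hj', ?_⟩⟩
    rw [exchange_apply']
    by_cases h1 : t = i
    · have h2 : t ≠ j := by rintro rfl; subst h1; omega
      subst h1
      exact hp (a t) _ (b t) ha.2 hb.2 (by simp [h2]) (by simp [h2]; omega)
    · by_cases h2 : t = j
      · subst h2
        exact hp (b t) _ (a t) hb.2 ha.2 (by simp [h1]; omega) (by simp [h1])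
      · simpa [h1, h2] using ha.2

/-- Only a coordinate with b i < a i is lowered, and b i ≥ c i leaves room for that. -/
theorem filter_ge {P : Finset (ι → ℤ)} (h : ExchangeClosed P) (c : ι → ℤ) :
    ExchangeClosed (P.filter fun a => ∀ i, c i ≤ a i) := by
  refine ⟨fun a ha b hb => h.sum_eq a (mem_filter.1 ha).1 b (mem_filter.1 hb).1, ?_, ?_⟩
  · intro a ha b hb i hi
    rw [mem_filter] at ha hb
    obtain ⟨j, hj, hj'⟩ := h.lower a ha.1 b hb.1 i hi
    refine ⟨j, hj, mem_filter.2 ⟨hj', fun k => ?_⟩⟩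
    rw [exchange_apply]
    have h1 := ha.2 k
    have h2 := hb.2 k
    split_ifs with h3 h4 h4 <;> subst_vars <;> omega
  · intro a ha b hb i hi
    rw [mem_filter] at ha hb
    obtain ⟨j, hj, hj'⟩ := h.raise a ha.1 b hb.1 i hi
    refine ⟨j, hj, mem_filter.2 ⟨hj', fun k => ?_⟩⟩
    rw [exchange_apply']
    have h1 := ha.2 k
    have h2 := hb.2 k
    split_ifs with h3 h4 h4 <;> subst_vars <;> omega

end ExchangeClosed

/-! ### Independence of the order -/

/-- A minimiser of the weight ∑ r i * a i works: an exchange from i to j with r j < r i would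
decrease the weight. -/
theorem exists_inactive_eq_empty (r : ι → ℕ) {P : Finset (ι → ℤ)} (hP : P.Nonempty) :
    ∃ a ∈ P, inactive r P a = ∅ := by
  obtain ⟨a, ha, hmin⟩ := exists_min_image P (fun a => ∑ i, (r i : ℤ) * a i) hP
  refine ⟨a, ha, eq_empty_of_forall_notMem fun i hi => ?_⟩
  obtain ⟨j, hj, hmem⟩ := mem_inactive.1 hi
  have h := hmin _ hmem
  simp only [exchange_apply, mul_add, mul_sub, sum_add_distrib, sum_sub_distrib, mul_ite, mul_one,
    mul_zero, sum_ite_eq', mem_univ, if_true] at h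
  omega

namespace ExchangeClosed

/-- At the last index i where a and b differ, the larger vector can be lowered. The index raised in
return is another place where they differ, hence comes earlier, so i is inactive. -/
theorem eq_of_inactive_eq_empty {r : ι → ℕ} (hr : r.Injective) {P : Finset (ι → ℤ)}
    (h : ExchangeClosed P) {a b : ι → ℤ} (ha : a ∈ P) (hb : b ∈ P)
    (ha' : inactive r P a = ∅) (hb' : inactive r P b = ∅) : a = b := by
  by_contra hab
  have hne : (univ.filter fun i => a i ≠ b i).Nonempty := by
    obtain ⟨i, hi⟩ := Function.ne_iff.1 hab
    exact ⟨i, by simpa using hi⟩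
  obtain ⟨i, hi, hmax⟩ := exists_max_image _ r hne
  have key : ∀ {a b : ι → ℤ}, a ∈ P → b ∈ P → inactive r P a = ∅ → b i < a i →
      (∀ j, a j ≠ b j → r j ≤ r i) → False := by
    intro a b ha hb ha' hlt hm
    obtain ⟨j, hj, hmem⟩ := h.lower a ha b hb i hlt
    have hji : j ≠ i := by rintro rfl; omega
    have : i ∈ inactive r P a :=
      mem_inactive.2 ⟨j, lt_of_le_of_ne (hm j hj.ne) (hr.ne hji), hmem⟩
    simp [ha'] at this
  have hm : ∀ j, a j ≠ b j → r j ≤ r i := fun j hj => hmax j (by simpa using hj)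
  rcases lt_or_gt_of_ne (mem_filter.1 hi).2 with h1 | h1
  · exact key hb ha hb' h1 fun j hj => hm j hj.symm
  · exact key ha hb ha' h1 hm

/-- An exchange at i decreases only coordinate i, so truncation at c blocks it exactly when a i = c
i. -/
theorem inactive_filter_ge (r : ι → ℕ) (P : Finset (ι → ℤ)) {a c : ι → ℤ} (hc : ∀ i, c i ≤ a i) :
    inactive r (P.filter fun a => ∀ i, c i ≤ a i) a = ∅ ↔ ∀ i ∈ inactive r P a, a i = c i := by
  constructor
  · intro h i hi
    by_contra hne
    have hlt : c i < a i := lt_of_le_of_ne (hc i) (Ne.symm hne)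
    obtain ⟨j, hj, hmem⟩ := mem_inactive.1 hi
    have : i ∈ inactive r (P.filter fun a => ∀ i, c i ≤ a i) a := by
      refine mem_inactive.2 ⟨j, hj, mem_filter.2 ⟨hmem, fun k => ?_⟩⟩
      rw [exchange_apply]
      have := hc k
      split_ifs with h3 h4 h4 <;> subst_vars <;> omega
    simp [h] at this
  · intro h
    refine eq_empty_of_forall_notMem fun i hi => ?_
    obtain ⟨j, hj, hmem⟩ := mem_inactive.1 hi
    rw [mem_filter] at hmem
    have h1 := h i (mem_inactive.2 ⟨j, hj, hmem.1⟩)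
    have h2 := hmem.2 i
    have hij : i ≠ j := by rintro rfl; omega
    rw [exchange_apply] at h2
    simp [hij] at h2
    omega

/-- Every vector `c` below `P` is `a - d` for a unique `a ∈ P` and a unique `d ≥ 0` supported on the
internally active indices of `a`. -/
theorem card_sigma_antidiag {r : ι → ℕ} (hr : r.Injective) {P : Finset (ι → ℤ)}
    (h : ExchangeClosed P) {s : ℤ} (hs : ∀ a ∈ P, ∑ i, a i = s) (m : ℕ) :
    (∑ a ∈ P, #(piAntidiag (inactive r P a)ᶜ m) : ℕ)
      = Set.ncard {c : ι → ℤ | (∃ a ∈ P, ∀ i, c i ≤ a i) ∧ ∑ i, c i = s - m} := by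
  rw [← card_sigma, ← Set.ncard_coe_finset]
  refine Set.ncard_congr (fun x _ => x.1 - fun i => (x.2 i : ℤ)) ?_ ?_ ?_
  · rintro ⟨a, d⟩ hx
    simp only [coe_sigma, Set.mem_sigma_iff, mem_coe, mem_piAntidiag] at hx
    obtain ⟨ha, hd, hd'⟩ := hx
    refine ⟨⟨a, ha, fun i => by simp⟩, ?_⟩
    have : ∑ i, (d i : ℤ) = m := by
      rw [← hd, Nat.cast_sum]
      refine (sum_subset (subset_univ _) fun i _ hi => ?_).symm
      by_contra hne
      exact hi (hd' i (by simpa using hne))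
    simp [hs a ha, this]
  · rintro ⟨a, d⟩ ⟨b, e⟩ hx hy hxy
    simp only [coe_sigma, Set.mem_sigma_iff, mem_coe, mem_piAntidiag] at hx hy hxy
    have hval : ∀ i, a i - d i = b i - e i := fun i => congrFun hxy i
    set c : ι → ℤ := a - fun i => (d i : ℤ) with hc
    have hca : (∀ i, c i ≤ a i) := fun i => by simp [hc]
    have hcb : (∀ i, c i ≤ b i) := fun i => by simp [hc, hval i]
    -- Both a and b lack inactive indices in the part of P above c, because d and e vanish at
    -- indices inactive in P; such a vector is unique.
    have hab : a = b := by
      refine (h.filter_ge c).eq_of_inactive_eq_empty hr (mem_filter.2 ⟨hx.1, hca⟩)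
        (mem_filter.2 ⟨hy.1, hcb⟩) ((inactive_filter_ge r P hca).2 fun i hi => ?_)
        ((inactive_filter_ge r P hcb).2 fun i hi => ?_)
      · by_contra hne
        have := hx.2.2 i (by rintro h0; simp [hc, h0] at hne)
        simp [hi] at this
      · by_contra hne
        have := hy.2.2 i (by rintro h0; simp [hc, hval i, h0] at hne)
        simp [hi] at this
    subst hab
    have : d = e := funext fun i => by have := hval i; omega
    rw [this]
  · rintro c ⟨⟨a₀, ha₀, hc₀⟩, hsum⟩
    -- The vector above c without inactive indices in the truncated set agrees with c wherever it is
    -- inactive in P, so d = a - c has the required support.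
    obtain ⟨a, ha, hact⟩ := exists_inactive_eq_empty r
      (P := P.filter fun a => ∀ i, c i ≤ a i) ⟨a₀, mem_filter.2 ⟨ha₀, hc₀⟩⟩
    rw [mem_filter] at ha
    rw [inactive_filter_ge r P ha.2] at hact
    have hd : ∀ i, ((a i - c i).toNat : ℤ) = a i - c i := fun i =>
      Int.toNat_of_nonneg (by have := ha.2 i; omega)
    have hsupp : ∀ i, (a i - c i).toNat ≠ 0 → i ∈ (inactive r P a)ᶜ := by
      intro i hi
      rw [mem_compl]
      intro hi'
      exact hi (by simp [hact i hi'])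
    refine ⟨⟨a, fun i => (a i - c i).toNat⟩, ?_, ?_⟩
    · simp only [coe_sigma, Set.mem_sigma_iff, mem_coe, mem_piAntidiag]
      refine ⟨ha.1, ?_, hsupp⟩
      have h1 : ∑ i ∈ (inactive r P a)ᶜ, (a i - c i).toNat = ∑ i, (a i - c i).toNat :=
        sum_subset (subset_univ _) fun i _ hi => by
          by_contra hne
          exact hi (hsupp i hne)
      rw [h1]
      zify
      simp only [hd, sum_sub_distrib, hs a ha.1, hsum]
      ring
    · funext i
      simp [hd]

end ExchangeClosed

theorem card_piAntidiag_eq_coeff (S : Finset ι) (m : ℕ) :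
    (#(piAntidiag S m) : ℤ) = PowerSeries.coeff m ((PowerSeries.mk 1 : PowerSeries ℤ) ^ #S) := by
  rw [← prod_const, PowerSeries.coeff_prod]
  simp only [PowerSeries.coeff_mk, Pi.one_apply, prod_const_one, sum_const, nsmul_eq_mul, mul_one,
    Nat.cast_inj]
  refine card_nbij' Finsupp.equivFunOnFinite.symm (fun d => ⇑d) ?_ ?_ ?_ ?_
  · intro d hd
    simp only [mem_coe, mem_piAntidiag, mem_finsuppAntidiag] at hd ⊢
    exact ⟨hd.1, fun i hi => hd.2 i (by simpa using hi)⟩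
  · intro d hd
    simp only [mem_coe, mem_piAntidiag, mem_finsuppAntidiag] at hd ⊢
    exact ⟨hd.1, fun i hi => hd.2 (by simpa using hi)⟩
  · intro d _
    rfl
  · intro d _
    ext i
    rfl

/-- Since `mk 1` is the inverse of 1 - X, each a contributes (1 - X) to the power n - |active| =
|inactive|, where n is the number of indices. -/
theorem interiorPoly_comp_one_sub (r : ι → ℕ) (P : Finset (ι → ℤ)) :
    (((interiorPoly r P).comp (1 - X) : ℤ[X]) : PowerSeries ℤ)
      = (∑ a ∈ P, (PowerSeries.mk 1 : PowerSeries ℤ) ^ #(inactive r P a)ᶜ)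
        * (1 - PowerSeries.X) ^ Fintype.card ι := by
  have h1 : (PowerSeries.mk 1 : PowerSeries ℤ) * (1 - PowerSeries.X) = 1 :=
    PowerSeries.mk_one_mul_one_sub_eq_one ℤ
  rw [interiorPoly, Polynomial.sum_comp, sum_mul, ← Polynomial.coeToPowerSeries.ringHom_apply,
    map_sum]
  refine sum_congr rfl fun a _ => ?_
  rw [← card_compl_add_card (inactive r P a), pow_add, ← mul_assoc, ← mul_pow, h1, one_pow, one_mul]
  simp

theorem ExchangeClosed.interiorPoly_eq {r r' : ι → ℕ} (hr : r.Injective) (hr' : r'.Injective)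
    {P : Finset (ι → ℤ)} (h : ExchangeClosed P) : interiorPoly r P = interiorPoly r' P := by
  rcases P.eq_empty_or_nonempty with rfl | ⟨a₀, ha₀⟩
  · simp [interiorPoly]
  have hs : ∀ a ∈ P, ∑ i, a i = ∑ i, a₀ i := fun a ha => h.sum_eq a ha a₀ ha₀
  have h1 : (∑ a ∈ P, (PowerSeries.mk 1 : PowerSeries ℤ) ^ #(inactive r P a)ᶜ)
      = ∑ a ∈ P, (PowerSeries.mk 1 : PowerSeries ℤ) ^ #(inactive r' P a)ᶜ := by
    ext m
    simp only [map_sum, ← card_piAntidiag_eq_coeff, ← Nat.cast_sum]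
    rw [h.card_sigma_antidiag hr hs, h.card_sigma_antidiag hr' hs]
  have h2 : (interiorPoly r P).comp (1 - X) = (interiorPoly r' P).comp (1 - X) := by
    apply Polynomial.coe_injective
    rw [interiorPoly_comp_one_sub, interiorPoly_comp_one_sub, h1]
  have h3 := congrArg (fun p => p.comp (1 - X)) h2
  simpa [Polynomial.comp_assoc] using h3

end Exchange

/-! ### Monotonicity under inclusion -/

section Monotonicity

variable {ι : Type*} [Fintype ι] [DecidableEq ι]

theorem coeff_interiorPoly (r : ι → ℕ) (P : Finset (ι → ℤ)) (k : ℕ) :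
    (interiorPoly r P).coeff k = #{a ∈ P | k = #(inactive r P a)} := by
  simp [interiorPoly, coeff_X_pow]

/-- If `t` is the largest index, then the interior polynomial decomposes into that of the part
`a t ≤ c` and those of the slices `a t = k` with `k > c`. -/
theorem ExchangeClosed.interiorPoly_eq_add {P : Finset (ι → ℤ)} (h : ExchangeClosed P) {t : ι}
    {r : ι → ℕ} (ht : ∀ i, i ≠ t → r i < r t) {c : ℤ} (hc : ∃ b ∈ P, b t ≤ c) {K : Finset ℤ}
    (hK : ∀ a ∈ P, c < a t → a t ∈ K) (hK' : ∀ k ∈ K, c < k) :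
    interiorPoly r P = interiorPoly r (P.filter fun a => a t ≤ c)
      + ∑ k ∈ K, X * interiorPoly r (P.filter fun a => a t = k) := by
  obtain ⟨b, hb, hbt⟩ := hc
  have hne : ∀ {i j}, r j < r i → j ≠ t := by
    rintro i j hij rfl
    by_cases h1 : i = j
    · subst h1; omega
    · have := ht i h1; omega
  -- With t last, no exchange defining inactivity raises coordinate t, so the cut a t ≤ c is
  -- respected.
  have hlow : ∀ a ∈ P.filter (fun a => a t ≤ c),
      inactive r P a = inactive r (P.filter fun a => a t ≤ c) a := by
    intro a ha
    ext i
    simp only [mem_inactive, mem_filter, exchange_apply]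
    refine exists_congr fun j => and_congr_right fun hj => ?_
    have h1 := (mem_filter.1 ha).2
    have h2 := (hne hj).symm
    simp only [h2, if_false, add_zero, iff_self_and]
    intro _
    split_ifs <;> omega
  -- The extra 1 is t itself: lowering towards b makes it inactive in P, while within a slice
  -- coordinate t cannot move. Exchanges at other indices fix coordinate t.
  have hhigh : ∀ k ∈ K, ∀ a ∈ P.filter (fun a => a t = k),
      #(inactive r P a) = #(inactive r (P.filter fun a => a t = k) a) + 1 := by
    intro k hk a ha
    rw [mem_filter] at ha
    have h1 : inactive r P a = insert t (inactive r (P.filter fun a => a t = k) a) := by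
      ext i
      rw [mem_insert]
      by_cases hi : i = t
      · subst hi
        simp only [true_or, iff_true]
        obtain ⟨j, hj, hmem⟩ := h.lower a ha.1 b hb i (by have := hK' k hk; omega)
        refine mem_inactive.2 ⟨j, ht j ?_, hmem⟩
        rintro rfl
        have := hK' k hk
        omega
      · simp only [hi, false_or, mem_inactive, mem_filter, exchange_apply]
        refine exists_congr fun j => and_congr_right fun hj => ?_
        simp [(hne hj).symm, Ne.symm hi, ha.2]
    rw [h1, card_insert_of_notMem]
    simp only [mem_inactive, mem_filter, exchange_apply, not_exists, not_and]
    intro j hj _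
    simp [(hne hj).symm, ha.2]
  have hhigh' : ∑ a ∈ P.filter (fun a => ¬ a t ≤ c), (X : ℤ[X]) ^ #(inactive r P a)
      = ∑ k ∈ K, X * interiorPoly r (P.filter fun a => a t = k) := by
    rw [← sum_fiberwise_of_maps_to (t := K) (g := fun a => a t)]
    · refine sum_congr rfl fun k hk => ?_
      rw [interiorPoly, mul_sum, filter_filter]
      have h2 : (P.filter fun a => ¬ a t ≤ c ∧ a t = k) = P.filter fun a => a t = k := by
        refine filter_congr fun a _ => ?_
        have := hK' k hk
        omega
      rw [h2]
      refine sum_congr rfl fun a ha => ?_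
      rw [hhigh k hk a ha, pow_succ']
    · intro a ha
      rw [mem_filter] at ha
      exact hK a ha.1 (by omega)
  rw [← hhigh', interiorPoly, ← sum_filter_add_sum_filter_not P (fun a => a t ≤ c)]
  congr 1
  exact sum_congr rfl fun a ha => by rw [hlow a ha]

/-- If `t` is the smallest index, then the interior polynomial of the top slice `a t = c` is
dominated by the interior polynomial of `P`. -/
theorem coeff_interiorPoly_slice_le {P : Finset (ι → ℤ)} {t : ι} {r : ι → ℕ}
    (ht : ∀ i, r t ≤ r i) {c : ℤ} (hc : ∀ a ∈ P, a t ≤ c) (k : ℕ) :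
    (interiorPoly r (P.filter fun a => a t = c)).coeff k ≤ (interiorPoly r P).coeff k := by
  rw [coeff_interiorPoly, coeff_interiorPoly, Nat.cast_le]
  refine card_le_card fun a ha => ?_
  simp only [mem_filter] at ha ⊢
  refine ⟨ha.1.1, ha.2.trans (congrArg card ?_)⟩
  ext i
  simp only [mem_inactive, mem_filter, exchange_apply]
  refine exists_congr fun j => and_congr_right fun hj => ?_
  -- With t first, an exchange in P never lowers coordinate t, and the bound c keeps it from rising,
  -- so it stays in the slice.
  refine and_iff_left_of_imp fun hmem => ?_
  have hit : t ≠ i := by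
    rintro rfl
    have := ht j
    omega
  have h1 := hc _ hmem
  rw [exchange_apply] at h1
  simp only [hit, if_false] at h1 ⊢
  split_ifs at h1 ⊢ <;> omega

omit [DecidableEq ι] in
theorem exists_order_max (t : ι) :
    ∃ r : ι → ℕ, r.Injective ∧ ∀ i, i ≠ t → r i < r t := by
  classical
  obtain ⟨e⟩ := Fintype.truncEquivFin ι |>.nonempty
  refine ⟨fun i => if i = t then Fintype.card ι else e i, fun i j hij => ?_, fun i hi => ?_⟩
  · have h1 := (e i).2
    have h2 := (e j).2
    dsimp only at hij
    split_ifs at hij with h3 h4 h4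
    · rw [h3, h4]
    · omega
    · omega
    · exact e.injective (Fin.ext hij)
  · simp [hi]

omit [DecidableEq ι] in
theorem exists_order_min (t : ι) :
    ∃ r : ι → ℕ, r.Injective ∧ ∀ i, r t ≤ r i := by
  classical
  obtain ⟨e⟩ := Fintype.truncEquivFin ι |>.nonempty
  refine ⟨fun i => if i = t then 0 else e i + 1, fun i j hij => ?_, fun i => by simp⟩
  dsimp only at hij
  split_ifs at hij with h3 h4 h4
  · rw [h3, h4]
  · exact e.injective (Fin.ext (by omega))

/-- S contains the coordinates that may vary on P; slicing at t removes t from S. Order independence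
lets t be last for the decomposition and first for the top-slice comparison. -/
theorem ExchangeClosed.coeff_interiorPoly_mono_of_eqOn (S : Finset ι) :
    ∀ {P Q : Finset (ι → ℤ)}, ExchangeClosed P → ExchangeClosed Q → Q ⊆ P →
      (∀ a ∈ P, ∀ b ∈ P, ∀ i ∉ S, a i = b i) → ∀ {r : ι → ℕ}, r.Injective → ∀ k,
        (interiorPoly r Q).coeff k ≤ (interiorPoly r P).coeff k := by
  induction S using Finset.induction_on with
  | empty =>
    intro P Q hP hQ hQP hconst r _ k
    rcases Q.eq_empty_or_nonempty with rfl | ⟨a, ha⟩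
    · simp [coeff_interiorPoly]
    · have : Q = P := hQP.antisymm fun b hb => by
        rwa [show b = a from funext fun i => hconst b hb a (hQP ha) i (notMem_empty i)]
      rw [this]
  | insert t S _ ih =>
    intro P Q hP hQ hQP hconst r hr k
    rcases Q.eq_empty_or_nonempty with rfl | hne
    · simp [coeff_interiorPoly]
    obtain ⟨a₀, ha₀, hmin⟩ := exists_min_image Q (fun a => a t) hne
    set c := a₀ t with hc
    obtain ⟨r₁, hr₁, ht₁⟩ := exists_order_max t
    obtain ⟨r₂, hr₂, ht₂⟩ := exists_order_min t
    have hslice : ∀ {R : Finset (ι → ℤ)}, ExchangeClosed R → ∀ k : ℤ,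
        ExchangeClosed (R.filter fun a => a t = k) := fun hR k =>
      hR.filter_ordConnected t (fun x => x = k) (by intros; omega)
    have hcut : ∀ {R : Finset (ι → ℤ)}, ExchangeClosed R →
        ExchangeClosed (R.filter fun a => a t ≤ c) := fun hR =>
      hR.filter_ordConnected t (fun x => x ≤ c) (by intros; omega)
    have hIH : ∀ (l : ℤ) (k : ℕ), (interiorPoly r₁ (Q.filter fun a => a t = l)).coeff k
        ≤ (interiorPoly r₁ (P.filter fun a => a t = l)).coeff k := by
      intro l k
      refine ih (hslice hP l) (hslice hQ l) (filter_subset_filter _ hQP) ?_ hr₁ k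
      intro a ha b hb i hi
      rw [mem_filter] at ha hb
      by_cases h1 : i = t
      · rw [h1, ha.2, hb.2]
      · exact hconst a ha.1 b hb.1 i (by simp [h1, hi])
    have hQcut : (Q.filter fun a => a t ≤ c) = Q.filter fun a => a t = c :=
      filter_congr fun a ha => ⟨fun h => le_antisymm h (hmin a ha), fun h => h.le⟩
    have hPcut : (P.filter fun a => a t = c)
        = (P.filter fun a => a t ≤ c).filter fun a => a t = c := by
      rw [filter_filter]
      exact filter_congr fun a _ => ⟨fun h => ⟨h.le, h⟩, fun h => h.2⟩
    have hfirst : ∀ k, (interiorPoly r₁ (Q.filter fun a => a t ≤ c)).coeff k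
        ≤ (interiorPoly r₁ (P.filter fun a => a t ≤ c)).coeff k := by
      intro k
      rw [hQcut]
      refine (hIH c k).trans ?_
      rw [(hslice hP c).interiorPoly_eq hr₁ hr₂, (hcut hP).interiorPoly_eq hr₁ hr₂, hPcut]
      exact coeff_interiorPoly_slice_le ht₂ (fun a ha => (mem_filter.1 ha).2) k
    -- The values on P index the slices of both sets; those missed by Q give empty slices.
    have hK : ∀ a ∈ P, c < a t → a t ∈ (P.image fun a => a t).filter fun x => c < x :=
      fun a ha h => mem_filter.2 ⟨mem_image_of_mem _ ha, h⟩
    have hK' : ∀ l ∈ (P.image fun a => a t).filter fun x => c < x, c < l :=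
      fun l hl => (mem_filter.1 hl).2
    rw [hP.interiorPoly_eq hr hr₁, hQ.interiorPoly_eq hr hr₁,
      hP.interiorPoly_eq_add ht₁ ⟨a₀, hQP ha₀, le_rfl⟩ hK hK',
      hQ.interiorPoly_eq_add ht₁ ⟨a₀, ha₀, le_rfl⟩ (fun a ha => hK a (hQP ha)) hK',
      coeff_add, coeff_add, finsetSum_coeff, finsetSum_coeff]
    refine add_le_add (hfirst k) (sum_le_sum fun l _ => ?_)
    cases k with
    | zero => simp
    | succ k => simpa only [coeff_X_mul] using hIH l k

/-- The coefficients of the interior polynomial are monotone under inclusion. -/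
theorem ExchangeClosed.coeff_interiorPoly_mono {P Q : Finset (ι → ℤ)} (hP : ExchangeClosed P)
    (hQ : ExchangeClosed Q) (hQP : Q ⊆ P) {r : ι → ℕ} (hr : r.Injective) (k : ℕ) :
    (interiorPoly r Q).coeff k ≤ (interiorPoly r P).coeff k :=
  coeff_interiorPoly_mono_of_eqOn univ hP hQ hQP (fun _ _ _ _ i hi => absurd (mem_univ i) hi) hr k

/-! ### Extension by constant coordinates -/

/-- The vector which is `b + v` on the coordinates in the range of `τ`, and `v` elsewhere. -/
noncomputable def extendAdd {κ : Type*} (τ : κ ↪ ι) (v : ι → ℤ) (b : κ → ℤ) : ι → ℤ :=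
  Function.extend τ b 0 + v

variable {κ : Type*} (τ : κ ↪ ι) (v : ι → ℤ)

omit [Fintype ι] [DecidableEq ι] in
theorem extendAdd_apply (b : κ → ℤ) (k : κ) : extendAdd τ v b (τ k) = b k + v (τ k) := by
  simp [extendAdd, τ.injective.extend_apply]

omit [Fintype ι] [DecidableEq ι] in
theorem extendAdd_apply_of_notMem (b : κ → ℤ) {i : ι} (hi : i ∉ Set.range τ) :
    extendAdd τ v b i = v i := by
  simp [extendAdd, Function.extend_apply' _ _ _ hi]

omit [Fintype ι] [DecidableEq ι] in
theorem extendAdd_injective : Function.Injective (extendAdd τ v) := by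
  intro a b hab
  funext k
  have := congrFun hab (τ k)
  simpa [extendAdd_apply] using this

omit [Fintype ι] in
theorem extendAdd_exchange [DecidableEq κ] (b : κ → ℤ) (i j : κ) :
    extendAdd τ v b - Pi.single (τ i) 1 + Pi.single (τ j) 1
      = extendAdd τ v (b - Pi.single i 1 + Pi.single j 1) := by
  funext l
  rw [exchange_apply]
  by_cases hl : l ∈ Set.range τ
  · obtain ⟨k, rfl⟩ := hl
    simp only [extendAdd_apply, exchange_apply, τ.injective.eq_iff]
    ring
  · have h1 : ∀ k, l ≠ τ k := fun k h => hl ⟨k, h.symm⟩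
    simp [extendAdd_apply_of_notMem τ v _ hl, h1]

variable [Fintype κ] [DecidableEq κ]

omit [Fintype ι] [DecidableEq κ] in
theorem sum_extendAdd (b : κ → ℤ) (I : Finset ι) :
    ∑ i ∈ I, extendAdd τ v b i = ∑ k with τ k ∈ I, b k + ∑ i ∈ I, v i := by
  simp only [extendAdd, Pi.add_apply, sum_add_distrib]
  congr 1
  have h1 : ∑ k with τ k ∈ I, b k = ∑ i ∈ (univ.filter fun k => τ k ∈ I).map τ,
      Function.extend τ b 0 i := by
    simp [τ.injective.extend_apply]
  rw [h1]
  refine (sum_subset ?_ ?_).symm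
  · intro i hi
    simp only [mem_map, mem_filter, mem_univ, true_and] at hi
    obtain ⟨k, hk, rfl⟩ := hi
    exact hk
  · intro i hi hi'
    refine Function.extend_apply' _ _ _ ?_
    rintro ⟨k, rfl⟩
    exact hi' (by simpa using hi)

theorem ExchangeClosed.image_extendAdd {Q : Finset (κ → ℤ)} (h : ExchangeClosed Q) :
    ExchangeClosed (Q.image (extendAdd τ v)) := by
  have hmem : ∀ (a b : κ → ℤ) (i : ι), extendAdd τ v a i ≠ extendAdd τ v b i → i ∈ Set.range τ := by
    intro a b i hi
    by_contra h1
    simp [extendAdd_apply_of_notMem τ v _ h1] at hi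
  refine ⟨?_, ?_, ?_⟩
  · simp only [mem_image]
    rintro _ ⟨a, ha, rfl⟩ _ ⟨b, hb, rfl⟩
    simp [sum_extendAdd, h.sum_eq a ha b hb]
  · simp only [mem_image]
    rintro _ ⟨a, ha, rfl⟩ _ ⟨b, hb, rfl⟩ i hi
    obtain ⟨k, rfl⟩ := hmem b a i hi.ne
    obtain ⟨j, hj, hj'⟩ := h.lower a ha b hb k (by simpa [extendAdd_apply] using hi)
    exact ⟨τ j, by simpa [extendAdd_apply] using hj, _, hj', (extendAdd_exchange τ v a k j).symm⟩
  · simp only [mem_image]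
    rintro _ ⟨a, ha, rfl⟩ _ ⟨b, hb, rfl⟩ i hi
    obtain ⟨k, rfl⟩ := hmem a b i hi.ne
    obtain ⟨j, hj, hj'⟩ := h.raise a ha b hb k (by simpa [extendAdd_apply] using hi)
    refine ⟨τ j, by simpa [extendAdd_apply] using hj, _, hj', ?_⟩
    rw [add_sub_right_comm, add_sub_right_comm, extendAdd_exchange]

/-- An exchange using an index outside the range of τ would alter a constant coordinate, so τ
matches the inactive sets. -/
theorem interiorPoly_image_extendAdd (r : ι → ℕ) (Q : Finset (κ → ℤ)) :
    interiorPoly r (Q.image (extendAdd τ v)) = interiorPoly (r ∘ τ) Q := by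
  have hinj := extendAdd_injective τ v
  rw [interiorPoly, sum_image hinj.injOn, interiorPoly]
  refine sum_congr rfl fun a _ => ?_
  rw [← card_map τ]
  congr 2
  ext i
  simp only [mem_inactive, mem_map]
  constructor
  · rintro ⟨j, hj, hmem⟩
    obtain ⟨b, hb, hab⟩ := mem_image.1 hmem
    have hji : j ≠ i := by rintro rfl; omega
    have hi : i ∈ Set.range τ := by
      by_contra h1
      have := congrFun hab i
      rw [exchange_apply] at this
      simp [extendAdd_apply_of_notMem τ v _ h1, hji.symm] at this
      omega
    have hj' : j ∈ Set.range τ := by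
      by_contra h1
      have := congrFun hab j
      rw [exchange_apply] at this
      simp [extendAdd_apply_of_notMem τ v _ h1, hji] at this
    obtain ⟨i, rfl⟩ := hi
    obtain ⟨j, rfl⟩ := hj'
    rw [extendAdd_exchange] at hab
    exact ⟨i, ⟨j, hj, hinj hab ▸ hb⟩, rfl⟩
  · rintro ⟨i, ⟨j, hj, hmem⟩, rfl⟩
    exact ⟨τ j, hj, by rw [extendAdd_exchange]; exact mem_image_of_mem _ hmem⟩

/-- If a translate of an extension of `Q` is contained in `P`, then the interior polynomial of `Q`
is dominated by that of `P`, for arbitrary orders. -/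
theorem ExchangeClosed.coeff_interiorPoly_le_of_extendAdd {P : Finset (ι → ℤ)}
    {Q : Finset (κ → ℤ)} (hP : ExchangeClosed P) (hQ : ExchangeClosed Q)
    (hQP : ∀ b ∈ Q, extendAdd τ v b ∈ P) {r : ι → ℕ} {r' : κ → ℕ} (hr : r.Injective)
    (hr' : r'.Injective) (k : ℕ) :
    (interiorPoly r' Q).coeff k ≤ (interiorPoly r P).coeff k := by
  -- The order on Q is replaced by the restriction of the order on P.
  rw [hQ.interiorPoly_eq hr' (hr.comp τ.injective), ← interiorPoly_image_extendAdd τ v]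
  exact hP.coeff_interiorPoly_mono (hQ.image_extendAdd τ v) (image_subset_iff.2 hQP) hr k

end Monotonicity

/-! ### Polymatroids of submodular functions -/

section Submodular

variable {ι : Type*} [DecidableEq ι]

/-- A submodular set function vanishing on the empty set. -/
structure IsSubmodular (f : Finset ι → ℤ) : Prop where
  empty : f ∅ = 0
  union_inter : ∀ I J, f (I ∪ J) + f (I ∩ J) ≤ f I + f J

namespace IsSubmodular

/-- Uncrossing: both sides of the submodular inequality have the same a-sum, so no slack remains. -/
theorem tight_union_inter {f : Finset ι → ℤ} (hf : IsSubmodular f) {a : ι → ℤ}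
    (ha : ∀ I, ∑ i ∈ I, a i ≤ f I) {I J : Finset ι} (hI : ∑ i ∈ I, a i = f I)
    (hJ : ∑ i ∈ J, a i = f J) :
    ∑ i ∈ I ∪ J, a i = f (I ∪ J) ∧ ∑ i ∈ I ∩ J, a i = f (I ∩ J) := by
  have h1 := sum_union_inter (s₁ := I) (s₂ := J) (f := a)
  have h2 := hf.union_inter I J
  have h3 := ha (I ∪ J)
  have h4 := ha (I ∩ J)
  constructor <;> linarith

theorem tight_biUnion {f : Finset ι → ℤ} (hf : IsSubmodular f) {a : ι → ℤ}
    (ha : ∀ I, ∑ i ∈ I, a i ≤ f I) (S : Finset ι) (T : ι → Finset ι)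
    (hT : ∀ j ∈ S, ∑ i ∈ T j, a i = f (T j)) : ∑ i ∈ S.biUnion T, a i = f (S.biUnion T) := by
  induction S using Finset.induction_on with
  | empty => simp [hf.empty]
  | insert j S _ ih =>
    rw [biUnion_insert]
    exact (hf.tight_union_inter ha (hT j (mem_insert_self _ _))
      (ih fun i hi => hT i (mem_insert_of_mem hi))).1

theorem tight_inf [Fintype ι] {f : Finset ι → ℤ} (hf : IsSubmodular f) {a : ι → ℤ}
    (ha : ∀ I, ∑ i ∈ I, a i ≤ f I) (htot : ∑ i, a i = f univ) (S : Finset ι) (T : ι → Finset ι)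
    (hT : ∀ j ∈ S, ∑ i ∈ T j, a i = f (T j)) : ∑ i ∈ S.inf T, a i = f (S.inf T) := by
  induction S using Finset.induction_on with
  | empty => simpa using htot
  | insert j S _ ih =>
    rw [inf_insert]
    exact (hf.tight_union_inter ha (hT j (mem_insert_self _ _))
      (ih fun i hi => hT i (mem_insert_of_mem hi))).2

variable {n : ℕ}

/-- The exchange increases the sum, by 1, only over sets containing j but not i, so a violated
constraint must have been tight. -/
theorem exchange_mem_or_tight {f : Finset (Fin n) → ℤ} {a : Fin n → ℤ} (ha : a ∈ polymatroid f)
    {i j : Fin n} (h : a - Pi.single i 1 + Pi.single j 1 ∉ polymatroid f) :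
    ∃ I, ∑ i ∈ I, a i = f I ∧ j ∈ I ∧ i ∉ I := by
  have hsum : ∀ I : Finset (Fin n), ∑ k ∈ I, (a - Pi.single i 1 + Pi.single j 1 : Fin n → ℤ) k
      = ∑ k ∈ I, a k - (if i ∈ I then 1 else 0) + (if j ∈ I then 1 else 0) := by
    intro I
    simp only [exchange_apply, sum_add_distrib, sum_sub_distrib, sum_ite_eq']
  by_contra! hI
  refine h ⟨fun I => ?_, by rw [hsum]; simpa using ha.2⟩
  rw [hsum]
  have h1 := ha.1 I
  have h2 := hI I
  by_cases h3 : j ∈ I <;> by_cases h4 : i ∈ I <;> simp only [h3, h4, if_true, if_false] <;>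
    try omega
  have h5 : ∑ k ∈ I, a k ≠ f I := fun h => h4 (h2 h h3)
  omega

/-- If every exchange fails, the blocking tight sets combine, by union when lowering and by
intersection when raising, into a tight set U on which b has larger sum than a, violating b(U) ≤ f
U. -/
theorem exchangeClosed {f : Finset (Fin n) → ℤ} (hf : IsSubmodular f) {P : Finset (Fin n → ℤ)}
    (hP : ∀ a, a ∈ P ↔ a ∈ polymatroid f) : ExchangeClosed P := by
  refine ⟨fun a ha b hb => ?_, fun a ha b hb i hi => ?_, fun a ha b hb i hi => ?_⟩
  · rw [hP] at ha hb
    rw [ha.2, hb.2]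
  · simp only [hP] at ha hb ⊢
    by_contra! hno
    have htight := fun j hj => exchange_mem_or_tight ha (hno j hj)
    choose! T hT hjT hiT using htight
    set U := (univ.filter fun j => a j < b j).biUnion T with hU
    have h1 : ∑ i ∈ U, a i = f U :=
      hf.tight_biUnion ha.1 _ T fun j hj => hT j (mem_filter.1 hj).2
    have h2 := hb.1 U
    have h3 : i ∉ U := by
      simp only [hU, mem_biUnion, mem_filter, mem_univ, true_and, not_exists, not_and]
      exact hiT
    have h4 : ∑ j ∈ Uᶜ, b j < ∑ j ∈ Uᶜ, a j := by
      refine sum_lt_sum (fun j hj => ?_) ⟨i, mem_compl.2 h3, hi⟩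
      by_contra! hlt
      refine (mem_compl.1 hj) (mem_biUnion.2 ⟨j, by simpa using hlt, hjT j hlt⟩)
    have h5 := sum_add_sum_compl U a
    have h6 := sum_add_sum_compl U b
    have h7 := ha.2
    have h8 := hb.2
    linarith
  · simp only [hP] at ha hb ⊢
    by_contra! hno
    have htight : ∀ j, b j < a j → ∃ I, ∑ i ∈ I, a i = f I ∧ i ∈ I ∧ j ∉ I := fun j hj =>
      exchange_mem_or_tight ha (by rw [← add_sub_right_comm]; exact hno j hj)
    choose! T hT hiT hjT using htight
    set U := (univ.filter fun j => b j < a j).inf T with hU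
    have h1 : ∑ i ∈ U, a i = f U :=
      hf.tight_inf ha.1 ha.2 _ T fun j hj => hT j (mem_filter.1 hj).2
    have h2 := hb.1 U
    have h3 : i ∈ U := by
      simp only [hU, mem_inf, mem_filter, mem_univ, true_and]
      exact hiT
    have h4 : ∑ j ∈ U, a j < ∑ j ∈ U, b j := by
      refine sum_lt_sum (fun j hj => ?_) ⟨i, h3, hi⟩
      by_contra! hlt
      exact hjT j hlt (mem_inf.1 hj j (by simpa using hlt))
    linarith

end IsSubmodular

/-- The greedy vector of a submodular function lies in its base polytope. -/
theorem IsSubmodular.exists_base [Fintype ι] {g : Finset ι → ℤ} (hg : IsSubmodular g) :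
    ∃ v : ι → ℤ, (∀ I, ∑ i ∈ I, v i ≤ g I) ∧ ∑ i, v i = g univ := by
  suffices h : ∀ S : Finset ι, ∃ v : ι → ℤ, (∀ I ⊆ S, ∑ i ∈ I, v i ≤ g I) ∧ ∑ i ∈ S, v i = g S by
    obtain ⟨v, hv, hv'⟩ := h univ
    exact ⟨v, fun I => hv I (subset_univ I), hv'⟩
  intro S
  induction S using Finset.induction_on with
  | empty =>
    refine ⟨0, fun I hI => ?_, by simp [hg.empty]⟩
    rw [subset_empty.1 hI]
    simp [hg.empty]
  | insert t S ht ih =>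
    obtain ⟨v, hv, hv'⟩ := ih
    set w := Function.update v t (g (insert t S) - g S) with hw
    have hsum : ∀ I ⊆ S, ∑ i ∈ I, w i = ∑ i ∈ I, v i := fun I hI =>
      sum_update_of_notMem (fun h => ht (hI h)) _ _
    have hwt : w t = g (insert t S) - g S := Function.update_self _ _ _
    refine ⟨w, fun I hI => ?_, ?_⟩
    · by_cases htI : t ∈ I
      · have hsub : I.erase t ⊆ S := by rwa [← subset_insert_iff]
        rw [← add_sum_erase I w htI, hsum _ hsub, hwt]
        -- The new coordinate is the marginal value of t over S, and submodularity bounds it by the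
        -- marginal value over the smaller set `I.erase t`.
        have h1 := hg.union_inter S I
        have h2 : S ∪ I = insert t S := by
          ext x
          have := @hI x
          simp only [mem_union, mem_insert] at this ⊢
          constructor
          · tauto
          · rintro (rfl | h)
            · exact Or.inr htI
            · exact Or.inl h
        have h3 : S ∩ I = I.erase t := by
          ext x
          have := @hI x
          simp only [mem_inter, mem_insert, mem_erase] at this ⊢
          constructor
          · rintro ⟨hx, hx'⟩
            exact ⟨by rintro rfl; exact ht hx, hx'⟩
          · tauto
        rw [h2, h3] at h1
        have h4 := hv _ hsub
        linarith
      · have hsub : I ⊆ S := (subset_insert_iff_of_notMem htI).1 hI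
        rw [hsum I hsub]
        exact hv I hsub
    · rw [sum_insert ht, hsum S Subset.rfl, hwt, hv']
      ring

end Submodular

/-! ### Comparison with the polynomials of a polymatroid -/

section Polymatroid

variable {n : ℕ}

theorem interiorPolynomial_eq_interiorPoly (P : Set (Fin n → ℤ)) (hP : P.Finite) :
    interiorPolynomial P hP = interiorPoly Fin.val hP.toFinset := by
  classical
  refine sum_congr rfl fun a _ => ?_
  congr 1
  have h1 : inactive Fin.val hP.toFinset a = (internallyActive P a)ᶜ := by
    ext i
    simp [mem_inactive, internallyActive]
  rw [h1, card_compl, Fintype.card_fin]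

theorem exteriorPolynomial_eq_interiorPoly (P : Set (Fin n → ℤ)) (hP : P.Finite) :
    exteriorPolynomial P hP = interiorPoly Fin.val (hP.toFinset.image fun a => -a) := by
  classical
  rw [interiorPoly, sum_image neg_injective.injOn]
  refine sum_congr rfl fun a _ => ?_
  congr 1
  have h1 : inactive Fin.val (hP.toFinset.image fun a => -a) (-a) = (externallyActive P a)ᶜ := by
    ext i
    simp only [mem_inactive, externallyActive, mem_compl, mem_filter, mem_univ, true_and, mem_image,
      Set.Finite.mem_toFinset, not_forall, not_not, exists_prop]
    refine exists_congr fun j => and_congr_right fun _ => ?_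
    have h2 : -a - Pi.single i 1 + Pi.single j 1 = -(a + Pi.single i 1 - Pi.single j 1) := by abel
    constructor
    · rintro ⟨b, hb, hab⟩
      rw [h2, neg_inj] at hab
      rwa [← hab]
    · exact fun h => ⟨_, h, h2.symm⟩
  rw [h1, card_compl, Fintype.card_fin]

/-- Domination of interior and exterior polynomials for a submodular function `g` which is, up to
the linear term `v`, smaller than `f`. -/
theorem coeff_polymatroid_le {n' : ℕ} {f : Finset (Fin n) → ℤ} {g : Finset (Fin n') → ℤ}
    (hf : IsSubmodular f) (hg : IsSubmodular g) (τ : Fin n' ↪ Fin n) (v : Fin n → ℤ)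
    (hle : ∀ I, g (univ.filter fun k => τ k ∈ I) + ∑ i ∈ I, v i ≤ f I)
    (heq : g univ + ∑ i, v i = f univ) (k : ℕ) :
    (interiorPolynomial (polymatroid g) (polymatroid_finite g)).coeff k
        ≤ (interiorPolynomial (polymatroid f) (polymatroid_finite f)).coeff k ∧
      (exteriorPolynomial (polymatroid g) (polymatroid_finite g)).coeff k
        ≤ (exteriorPolynomial (polymatroid f) (polymatroid_finite f)).coeff k := by
  have hP := hf.exchangeClosed (fun a => (polymatroid_finite f).mem_toFinset)
  have hQ := hg.exchangeClosed (fun a => (polymatroid_finite g).mem_toFinset)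
  have hmem : ∀ b ∈ (polymatroid_finite g).toFinset,
      extendAdd τ v b ∈ (polymatroid_finite f).toFinset := by
    intro b hb
    rw [Set.Finite.mem_toFinset] at hb ⊢
    refine ⟨fun I => ?_, ?_⟩
    · rw [sum_extendAdd]
      have := hb.1 (univ.filter fun k => τ k ∈ I)
      linarith [hle I]
    · rw [sum_extendAdd]
      simpa [hb.2] using heq
  rw [interiorPolynomial_eq_interiorPoly, interiorPolynomial_eq_interiorPoly,
    exteriorPolynomial_eq_interiorPoly, exteriorPolynomial_eq_interiorPoly]
  -- The exterior part compares the negated sets, where the translation becomes -v.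
  refine ⟨hP.coeff_interiorPoly_le_of_extendAdd τ v hQ hmem Fin.val_injective Fin.val_injective k,
    hP.neg.coeff_interiorPoly_le_of_extendAdd τ (-v) hQ.neg ?_ Fin.val_injective
      Fin.val_injective k⟩
  simp only [mem_image]
  rintro _ ⟨b, hb, rfl⟩
  refine ⟨_, hmem b hb, funext fun i => ?_⟩
  by_cases hi : i ∈ Set.range τ
  · obtain ⟨k, rfl⟩ := hi
    simp [extendAdd_apply]
    ring
  · simp [extendAdd_apply_of_notMem τ _ _ hi]

end Polymatroid

/-! ### Dimensions of sums of subspaces -/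

section Subspaces

open Module

variable {M : Type*} [AddCommGroup M] [Module ℚ M] {ι : Type*} [DecidableEq ι]

omit [DecidableEq ι] in
theorem finiteDimensional_biSup (U : ι → Submodule ℚ M) (hU : ∀ i, FiniteDimensional ℚ (U i))
    (I : Finset ι) : FiniteDimensional ℚ (⨆ i ∈ I, U i : Submodule ℚ M) := by
  rw [← Finset.sup_eq_iSup]
  exact Submodule.finiteDimensional_finset_sup I U

omit [DecidableEq ι] in
theorem finrank_biSup_empty (U : ι → Submodule ℚ M) :
    finrank ℚ (⨆ i ∈ (∅ : Finset ι), U i : Submodule ℚ M) = 0 := by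
  have h : (⨆ i ∈ (∅ : Finset ι), U i) = ⊥ := by simp
  rw [h, finrank_bot]

/-- The rank function of a family of subspaces, relative to a subspace `T`, is submodular. -/
theorem isSubmodular_finrank (U : ι → Submodule ℚ M) (hU : ∀ i, FiniteDimensional ℚ (U i))
    (T : Submodule ℚ M) [FiniteDimensional ℚ T] :
    IsSubmodular fun I : Finset ι =>
      (finrank ℚ ((⨆ i ∈ I, U i) ⊔ T : Submodule ℚ M) : ℤ) - finrank ℚ T := by
  have hempty : (⨆ i ∈ (∅ : Finset ι), U i) ⊔ T = T := by simp
  refine ⟨by rw [hempty, sub_self], fun I J => ?_⟩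
  have := finiteDimensional_biSup U hU
  have h1 := Submodule.finrank_sup_add_finrank_inf_eq ((⨆ i ∈ I, U i) ⊔ T) ((⨆ i ∈ J, U i) ⊔ T)
  have h2 : ((⨆ i ∈ I, U i) ⊔ T) ⊔ ((⨆ i ∈ J, U i) ⊔ T) = (⨆ i ∈ I ∪ J, U i) ⊔ T := by
    rw [Finset.iSup_union, sup_sup_sup_comm, sup_idem]
  have h3 : (⨆ i ∈ I ∩ J, U i) ⊔ T ≤ ((⨆ i ∈ I, U i) ⊔ T) ⊓ ((⨆ i ∈ J, U i) ⊔ T) :=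
    le_inf (sup_le_sup_right (biSup_mono fun i hi => (mem_inter.1 hi).1) T)
      (sup_le_sup_right (biSup_mono fun i hi => (mem_inter.1 hi).2) T)
  have h4 := Submodule.finrank_mono h3
  rw [h2] at h1
  omega

theorem isSubmodular_finrank_sub_card (U : ι → Submodule ℚ M)
    (hU : ∀ i, FiniteDimensional ℚ (U i)) :
    IsSubmodular fun I : Finset ι => (finrank ℚ (⨆ i ∈ I, U i : Submodule ℚ M) : ℤ) - #I := by
  have h := isSubmodular_finrank U hU ⊥
  refine ⟨by rw [finrank_biSup_empty]; simp, fun I J => ?_⟩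
  have h1 := h.union_inter I J
  have h2 := card_union_add_card_inter I J
  rw [sup_bot_eq, sup_bot_eq, sup_bot_eq, sup_bot_eq, finrank_bot] at h1
  omega

variable [Fintype ι] {κ : Type*} [Fintype κ]

/-- A linear term by which the ranks of a family of subspaces exceed those of a subfamily of
subspaces thereof. -/
theorem exists_linear_term (U : ι → Submodule ℚ M) (hU : ∀ i, FiniteDimensional ℚ (U i))
    (W : κ → Submodule ℚ M) (τ : κ ↪ ι) (hW : ∀ k, W k ≤ U (τ k)) :
    ∃ v : ι → ℤ,
      (∀ I : Finset ι, ((finrank ℚ (⨆ k ∈ univ.filter fun k => τ k ∈ I, W k : Submodule ℚ M) : ℤ)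
          - #(univ.filter fun k => τ k ∈ I)) + ∑ i ∈ I, v i
        ≤ (finrank ℚ (⨆ i ∈ I, U i : Submodule ℚ M) : ℤ) - #I) ∧
      ((finrank ℚ (⨆ k ∈ (univ : Finset κ), W k : Submodule ℚ M) : ℤ) - #(univ : Finset κ))
        + ∑ i, v i = (finrank ℚ (⨆ i ∈ (univ : Finset ι), U i : Submodule ℚ M) : ℤ)
          - #(univ : Finset ι) := by
  have hWfin : ∀ k, FiniteDimensional ℚ (W k) := fun k =>
    have := hU (τ k)
    Submodule.finiteDimensional_of_le (hW k)
  have hUI := finiteDimensional_biSup U hU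
  have hWJ := finiteDimensional_biSup W hWfin
  set T : Submodule ℚ M := ⨆ k ∈ (univ : Finset κ), W k with hT
  have : FiniteDimensional ℚ T := hWJ univ
  -- For this base, v(I) ≤ dim(U_I + T) - dim T = dim U_I - dim(U_I ∩ T), and U_I ∩ T contains every
  -- W k with τ k ∈ I.
  obtain ⟨v, hv, hv'⟩ := (isSubmodular_finrank U hU T).exists_base
  have hcount : ∀ I : Finset ι, ∑ i ∈ I, (if i ∈ univ.map τ then 0 else 1 : ℤ)
      = #I - #(univ.filter fun k => τ k ∈ I) := by
    intro I
    have h1 : ∑ i ∈ I, (if i ∈ univ.map τ then 0 else 1 : ℤ)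
        = ∑ i ∈ I, (1 - if i ∈ univ.map τ then 1 else 0 : ℤ) :=
      sum_congr rfl fun i _ => by split_ifs <;> simp
    have h2 : (univ.filter fun k => τ k ∈ I).map τ = I.filter fun i => i ∈ univ.map τ := by
      ext i
      simp only [mem_map, mem_filter, mem_univ, true_and]
      constructor
      · rintro ⟨k, hk, rfl⟩
        exact ⟨hk, k, rfl⟩
      · rintro ⟨hi, k, rfl⟩
        exact ⟨k, hi, rfl⟩
    rw [h1, sum_sub_distrib, sum_boole, ← h2, card_map]
    simp
  have hsum : ∀ I : Finset ι, ∑ i ∈ I, (v i - if i ∈ univ.map τ then 0 else 1)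
      = ∑ i ∈ I, v i - (#I - #(univ.filter fun k => τ k ∈ I)) := by
    intro I
    rw [sum_sub_distrib, hcount]
  -- The correction accounts for the cardinality terms: #I exceeds the number of k with τ k ∈ I by
  -- one for each index of I outside the range of τ.
  refine ⟨fun i => v i - if i ∈ univ.map τ then 0 else 1, fun I => ?_, ?_⟩
  · rw [hsum]
    have h1 := hv I
    have h2 := Submodule.finrank_sup_add_finrank_inf_eq (⨆ i ∈ I, U i) T
    have h3 : (⨆ k ∈ univ.filter fun k => τ k ∈ I, W k) ≤ (⨆ i ∈ I, U i) ⊓ T := by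
      refine le_inf (iSup₂_le fun k hk => ?_) (biSup_mono fun k _ => mem_univ k)
      exact (hW k).trans (le_iSup₂_of_le (τ k) (mem_filter.1 hk).2 le_rfl)
    have h4 := Submodule.finrank_mono h3
    omega
  · rw [hsum univ]
    have h3 : T ≤ ⨆ i ∈ (univ : Finset ι), U i :=
      iSup₂_le fun k _ => (hW k).trans (le_iSup₂_of_le (τ k) (mem_univ _) le_rfl)
    rw [sup_eq_left.2 h3] at hv'
    have h5 : (univ.filter fun k => τ k ∈ (univ : Finset ι)) = univ := by simp
    rw [h5]
    omega

end Subspaces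

/-! ### The rank of a graph -/

section Graph

open Module

/-- The number of vertices of a graph is the rank of its edges plus the number of components. -/
theorem SimpleGraph.finrank_span_edges_add_card {W : Type*} [Finite W] (G : SimpleGraph W) :
    finrank ℚ (Submodule.span ℚ
        {x : W →₀ ℚ | ∃ u w, G.Adj u w ∧ x = Finsupp.single u 1 - Finsupp.single w 1})
      + Nat.card G.ConnectedComponent = Nat.card W := by
  classical
  have := Fintype.ofFinite W
  have : Finite G.ConnectedComponent := Quot.finite _
  have := Fintype.ofFinite G.ConnectedComponent
  set U := Submodule.span ℚ
    {x : W →₀ ℚ | ∃ u w, G.Adj u w ∧ x = Finsupp.single u 1 - Finsupp.single w 1} with hU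
  set π : (W →₀ ℚ) →ₗ[ℚ] (G.ConnectedComponent →₀ ℚ) :=
    Finsupp.lmapDomain ℚ ℚ G.connectedComponentMk
  have hπsingle : ∀ w q, π (Finsupp.single w q) = Finsupp.single (G.connectedComponentMk w) q :=
    fun w q => Finsupp.mapDomain_single
  have hsurj : LinearMap.range π = ⊤ :=
    LinearMap.range_eq_top.2 (Finsupp.mapDomain_surjective Quot.mk_surjective)
  have hreach : ∀ u w, G.Reachable u w →
      (Finsupp.single u 1 - Finsupp.single w 1 : W →₀ ℚ) ∈ U := by
    rintro u w ⟨p⟩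
    induction p with
    | nil => simp
    | cons h _ ih =>
      have h1 := U.add_mem (Submodule.subset_span ⟨_, _, h, rfl⟩) ih
      simpa using h1
  have hker : LinearMap.ker π = U := by
    apply le_antisymm
    · intro x hx
      set ρ : (G.ConnectedComponent →₀ ℚ) →ₗ[ℚ] (W →₀ ℚ) :=
        Finsupp.lmapDomain ℚ ℚ (fun C : G.ConnectedComponent => Quot.out C)
      have hρsingle : ∀ C q, ρ (Finsupp.single C q) = Finsupp.single (Quot.out C) q :=
        fun C q => Finsupp.mapDomain_single
      -- ρ ∘ π moves each vertex to a chosen representative of its component, which changes y only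
      -- by an element of U.
      have h1 : ∀ y : W →₀ ℚ, y - ρ (π y) ∈ U := by
        intro y
        induction y using Finsupp.induction_linear with
        | zero => simp
        | add y z hy hz =>
          have := U.add_mem hy hz
          rwa [map_add, map_add, add_sub_add_comm]
        | single w q =>
          have h2 : G.Reachable w (Quot.out (G.connectedComponentMk w)) :=
            (SimpleGraph.ConnectedComponent.exact (Quot.out_eq (G.connectedComponentMk w))).symm
          have h3 := U.smul_mem q (hreach _ _ h2)
          rw [hπsingle, hρsingle]
          simpa [smul_sub] using h3
      have h2 := h1 x
      rw [LinearMap.mem_ker.1 hx] at h2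
      simpa using h2
    · rw [hU, Submodule.span_le]
      rintro _ ⟨u, w, h, rfl⟩
      have h1 : G.connectedComponentMk u = G.connectedComponentMk w :=
        SimpleGraph.ConnectedComponent.sound h.reachable
      rw [SetLike.mem_coe, LinearMap.mem_ker, map_sub, hπsingle, hπsingle, h1, sub_self]
  have h := LinearMap.finrank_range_add_finrank_ker π
  rw [hsurj, hker, finrank_top, finrank_finsupp_self, finrank_finsupp_self] at h
  rw [Nat.card_eq_fintype_card, Nat.card_eq_fintype_card]
  omega

end Graph

/-! ### Hypergraphs -/

namespace LabelledHypergraph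

open Module

variable {α β : Type*}

/-- The span of the differences of endpoints of the edges of `Bip H` at the hyperedge `e`. -/
noncomputable def star (H : LabelledHypergraph α β) (e : β) : Submodule ℚ (α ⊕ β →₀ ℚ) :=
  Submodule.span ℚ
    ((fun v => Finsupp.single (Sum.inl v) 1 - Finsupp.single (Sum.inr e) 1) '' (H.carrier e : Set α))

instance (H : LabelledHypergraph α β) (e : β) : FiniteDimensional ℚ (H.star e) :=
  FiniteDimensional.span_of_finite ℚ ((H.carrier e).finite_toSet.image _)

/-- The graph `H.bipRestrict S` has |⋃ S| + |S| vertices, so its edge vectors, which together span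
the sum of the stars, have rank |⋃ S| + |S| - c(S). Placing all stars in one ambient space makes
submodularity a fact about sums of subspaces. -/
theorem mu_eq_finrank (H : LabelledHypergraph α β) {S : Finset β} (hS : S ⊆ H.edges) :
    H.mu S = (finrank ℚ (⨆ e ∈ S, H.star e : Submodule ℚ (α ⊕ β →₀ ℚ)) : ℤ) - #S := by
  classical
  by_cases hS' : S = ∅
  · subst hS'
    rw [finrank_biSup_empty]
    simp [mu]
  rw [mu, if_neg hS']
  set B := H.bipRestrict S with hB
  have hverts : B.verts = ((S.biUnion H.carrier).disjSum S : Finset (α ⊕ β)) := by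
    ext x
    rcases x with v | e
    · simp only [hB, bipRestrict, Set.mem_ofPred_eq, mem_coe, inl_mem_disjSum, mem_biUnion]
      constructor
      · rintro (⟨e, _, _, h⟩ | ⟨e, he, _, w, hw, h⟩)
        · cases h
        · cases h
          exact ⟨e, he, hw⟩
      · rintro ⟨e, he, hv⟩
        exact Or.inr ⟨e, he, hS he, v, hv, rfl⟩
    · simp only [hB, bipRestrict, Set.mem_ofPred_eq, mem_coe, inr_mem_disjSum]
      constructor
      · rintro (⟨e', he', _, h⟩ | ⟨e', _, _, w, _, h⟩)
        · cases h
          exact he'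
        · cases h
      · intro he
        exact Or.inl ⟨e, he, hS he, rfl⟩
  have hcard : Nat.card B.verts = #(S.biUnion H.carrier) + #S := by
    rw [hverts, Nat.card_coe_set_eq, Set.ncard_coe_finset, card_disjSum]
  have hfin : Finite B.verts := by
    rw [hverts]
    exact Finset.finite_toSet _
  have hgraph := B.coe.finrank_span_edges_add_card
  set φ : (B.verts →₀ ℚ) →ₗ[ℚ] (α ⊕ β →₀ ℚ) := Finsupp.lmapDomain ℚ ℚ Subtype.val
  have hφsingle : ∀ w q, φ (Finsupp.single w q) = Finsupp.single w.1 q :=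
    fun w q => Finsupp.mapDomain_single
  have hφinj : Function.Injective φ := Finsupp.mapDomain_injective Subtype.val_injective
  have hspan : (⨆ e ∈ S, H.star e) = (Submodule.span ℚ {x : B.verts →₀ ℚ | ∃ u w, B.coe.Adj u w ∧
      x = Finsupp.single u 1 - Finsupp.single w 1}).map φ := by
    rw [Submodule.map_span]
    apply le_antisymm
    · refine iSup₂_le fun e he => Submodule.span_le.2 ?_
      rintro _ ⟨v, hv, rfl⟩
      have hadj : B.Adj (Sum.inl v) (Sum.inr e) :=
        ⟨e, he, hS he, v, hv, Or.inl ⟨rfl, rfl⟩⟩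
      refine Submodule.subset_span ⟨_, ⟨⟨_, B.edge_vert hadj⟩, ⟨_, B.edge_vert hadj.symm⟩, hadj,
        rfl⟩, ?_⟩
      rw [map_sub, hφsingle, hφsingle]
    · rw [Submodule.span_le]
      rintro _ ⟨_, ⟨⟨x, hx⟩, ⟨y, hy⟩, hadj, rfl⟩, rfl⟩
      have h1 : φ (Finsupp.single ⟨x, hx⟩ 1 - Finsupp.single ⟨y, hy⟩ 1)
          = Finsupp.single x 1 - Finsupp.single y 1 := by
        rw [map_sub, hφsingle, hφsingle]
      rw [h1]
      obtain ⟨e, he, _, v, hv, ⟨rfl, rfl⟩ | ⟨rfl, rfl⟩⟩ := hadj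
      · exact Submodule.mem_iSup_of_mem e (Submodule.mem_iSup_of_mem he
          (Submodule.subset_span ⟨v, hv, rfl⟩))
      · rw [← neg_sub]
        exact Submodule.neg_mem _ (Submodule.mem_iSup_of_mem e (Submodule.mem_iSup_of_mem he
          (Submodule.subset_span ⟨v, hv, rfl⟩)))
  have hrank : finrank ℚ (⨆ e ∈ S, H.star e : Submodule ℚ (α ⊕ β →₀ ℚ)) = finrank ℚ
      (Submodule.span ℚ {x : B.verts →₀ ℚ | ∃ u w, B.coe.Adj u w ∧
        x = Finsupp.single u 1 - Finsupp.single w 1}) := by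
    rw [hspan]
    exact (Submodule.equivMapOfInjective φ hφinj _).finrank_eq.symm
  rw [hrank]
  omega

theorem rank_eq_finrank (H : LabelledHypergraph α β) {n : ℕ} (σ : Fin n ≃ H.edges) :
    H.rank σ = fun I =>
      (finrank ℚ (⨆ i ∈ I, H.star (σ i) : Submodule ℚ (α ⊕ β →₀ ℚ)) : ℤ) - #I := by
  funext I
  rw [rank, mu_eq_finrank, card_map]
  · rw [← Finset.sup_eq_iSup, Finset.sup_map, Finset.sup_eq_iSup]
    rfl
  · intro e he
    obtain ⟨i, _, rfl⟩ := mem_map.1 he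
    exact (σ i).2

theorem edges_subset_of_bip_le {H H' : LabelledHypergraph α β} (h : H'.bip ≤ H.bip) :
    H'.edges ⊆ H.edges := by
  intro e he
  have h1 : Sum.inr e ∈ H.bip.verts := h.1 (Or.inr ⟨e, he, rfl⟩)
  rcases h1 with ⟨v, _, hv⟩ | ⟨e', he', h2⟩
  · cases hv
  · cases h2
    exact he'

theorem carrier_subset_of_bip_le {H H' : LabelledHypergraph α β} (h : H'.bip ≤ H.bip) {e : β}
    (he : e ∈ H'.edges) : H'.carrier e ⊆ H.carrier e := by
  intro v hv
  have h1 : H.bip.Adj (Sum.inl v) (Sum.inr e) := h.2 ⟨e, he, v, hv, Or.inl ⟨rfl, rfl⟩⟩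
  obtain ⟨e', _, w, hw, ⟨h2, h3⟩ | ⟨h2, _⟩⟩ := h1
  · cases h2
    cases h3
    exact hw
  · cases h2

end LabelledHypergraph

end

/-- The inequalities hold for all orderings `σ`, `σ'` of the hyperedges of `H` and of `H'`, chosen
independently of each other. -/
theorem corollary4p8 {α β : Type*} (H H' : LabelledHypergraph α β) (hsub : H'.bip ≤ H.bip)
    {n n' : ℕ} (σ : Fin n ≃ H.edges) (σ' : Fin n' ≃ H'.edges) :
    (∀ k : ℕ, (H'.interior σ').coeff k ≤ (H.interior σ).coeff k) ∧
      (∀ k : ℕ, (H'.exterior σ').coeff k ≤ (H.exterior σ).coeff k) := by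
  rw [← forall_and]
  intro k
  have hE := LabelledHypergraph.edges_subset_of_bip_le hsub
  let τ : Fin n' ↪ Fin n :=
    ⟨fun k => σ.symm ⟨σ' k, hE (σ' k).2⟩, fun i j hij => by
      have := σ.symm.injective hij
      simpa [Subtype.ext_iff, ← Subtype.ext_iff (a1 := σ' i)] using this⟩
  have hτ : ∀ k, H'.star (σ' k) ≤ H.star (σ (τ k)) := by
    intro k
    have h1 : (σ (τ k) : β) = σ' k := congrArg Subtype.val (σ.apply_symm_apply _)
    rw [h1]
    exact Submodule.span_mono (Set.image_mono
      (mod_cast LabelledHypergraph.carrier_subset_of_bip_le hsub (σ' k).2))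
  obtain ⟨v, hle, heq⟩ := exists_linear_term (fun i => H.star (σ i)) (fun _ => inferInstance)
    (fun k => H'.star (σ' k)) τ hτ
  refine coeff_polymatroid_le ?_ ?_ τ v ?_ ?_ k
  · rw [LabelledHypergraph.rank_eq_finrank]
    exact isSubmodular_finrank_sub_card _ fun _ => inferInstance
  · rw [LabelledHypergraph.rank_eq_finrank]
    exact isSubmodular_finrank_sub_card _ fun _ => inferInstance
  · simp only [LabelledHypergraph.rank_eq_finrank]
    exact hle
  · simp only [LabelledHypergraph.rank_eq_finrank]
    exact heq
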